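/- For $z \in \mathbb{C}\setminus\{0,-1,-2,\dots\}$ let $$H_1(z)=\sum_{n=0}^{\infty}\frac{1}{(n+z)^2}.$$ The following hold. 1. For every $z \in \mathbb{C}\setminus\{0,-1,-2,\dots\}$ the series converges, and $H_1 = D^2\log\Gamma$ at $z$, where $D = d/dz$: the Gamma function has a holomorphic branch of its logarithm near $z$, and every such branch $g$ satisfies $g''(z)=H_1(z)$. 2. For every $z \in \mathbb{C}\setminus\{0,-1,-2,\dots\}$, $$\Gamma''(z)\,\Gamma(z)-\Gamma'(z)^2-H_1(z)\,\Gamma(z)^2=0 .$$ 3. $H_1$ is a meromorphic function on $\mathbb{C}$ and is differentially transcendental over the field $\mathbb{C}(z)$ of complex rational functions: there are no $n \ge 0$ and no nonzero polynomial $P(y_0,y_1,\dots,y_n)$ with coefficients in $\mathbb{C}(z)$ such that $P(H_1,DH_1,\dots,D^nH_1)=0$ as a meromorphic function on $\mathbb{C}$. -/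

import Mathlib

/-- The function `H₁(z) = ∑_{n ≥ 0} 1 / (n + z)²`. The poles `0, -1, -2, …` carry a junk value, which
does not matter for `H₁` as a meromorphic function. -/
noncomputable def hOne (z : ℂ) : ℂ := ∑' n : ℕ, 1 / ((n : ℂ) + z) ^ 2

/-- The ring `ℂ(z){X}` of differential polynomials in one differential indeterminate `X` over the
field `ℂ(z)` of rational functions; the variable with index `i` stands for `Dⁱ X`. -/
abbrev DiffPoly : Type := MvPolynomial ℕ (RatFunc ℂ)

/-- The value at the point `z` of `P(f, Df, D²f, …)`. This is meaningful where `f` is analytic and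
no coefficient of `P` has a pole. -/
noncomputable def DiffPoly.evalAt (P : DiffPoly) (f : ℂ → ℂ) (z : ℂ) : ℂ :=
  ∑ m ∈ P.support, (P.coeff m).eval (RingHom.id ℂ) z * ∏ i ∈ m.support, iteratedDeriv i f z ^ m i

/-- A function `f` meromorphic on `ℂ` is differentially algebraic over `ℂ(z)` if
`P(f, Df, D²f, …) = 0` for some nonzero differential polynomial `P` over `ℂ(z)`. The equation is one
between meromorphic functions on `ℂ`, that is, it holds off a closed discrete set of points. -/
def IsDifferentiallyAlgebraic (f : ℂ → ℂ) : Prop :=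
  ∃ P : DiffPoly, P ≠ 0 ∧ ∀ᶠ z in Filter.codiscrete ℂ, P.evalAt f z = 0

/-- A function meromorphic on `ℂ` that is not differentially algebraic over `ℂ(z)`. -/
def IsDifferentiallyTranscendental (f : ℂ → ℂ) : Prop :=
  Meromorphic f ∧ ¬ IsDifferentiallyAlgebraic f

/-- `g` is a holomorphic branch of `log f` near the point `z`. -/
def IsLogBranchAt (g f : ℂ → ℂ) (z : ℂ) : Prop :=
  AnalyticAt ℂ g z ∧ ∀ᶠ w in nhds z, Complex.exp (g w) = f w

/-!
The function `H₁` satisfies `H₁(z + 1) = H₁(z) - 1 / z²`, and this alone forces differential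
transcendence. Write `I` for the ideal of all differential polynomials `P` over `ℂ(z)` with
`P(H₁, DH₁, …) = 0`. Differentiating the functional equation shows that `I` is stable under the
endomorphism `shiftHom` of `ℂ(z)[X₀, X₁, …]` that replaces `z` by `z + 1` in the coefficients and
`Xᵢ` by `Xᵢ + αᵢ / z ^ (i + 2)` for certain nonzero constants `αᵢ` (`diffEval_shiftHom`). If `I`
had a nonzero element, then an element that is minimal in the total degree and in the number of
monomials of that degree, and that has `1` among the coefficients of these monomials, would be
fixed by `shiftHom` (`shiftHom.eq_bot_of_stable`). The partial derivatives of a fixed polynomial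
are fixed, so by induction on the degree they are constants; a fixed polynomial is then
`g + ∑ cᵢ Xᵢ` with `cᵢ` of period `1`, that is, `cᵢ ∈ ℂ`, and `g(z) - g(z + 1) = ∑ cᵢ αᵢ / z ^ (i + 2)`
(`shiftHom.eq_C_of_fixed`). The right side has its only pole at `0` unless all `cᵢ` vanish,
whereas the poles of `g(z) - g(z + 1)` in `ℤ`, if there are any, are at least two in number
(`ratShift.ne_of_pole_at_zero`). So a fixed polynomial is constant, and `I` would contain a unit.
Equality of meromorphic functions is expressed by germs along the filter of codiscrete sets.

For the Gamma function, Euler's approximations `n ^ z n! / (z (z + 1) ⋯ (z + n))` satisfy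
`f'' f - f'² = f² ∑ 1 / (z + j)²` with the sum over `j ≤ n`. On the right half plane they converge to `Γ`
pointwise and are bounded by `Γ (re z)`, so by Cauchy's integral formula their derivatives
converge too (`tendsto_iteratedDeriv_of_bounded`), and the equation passes to the limit. The
identity theorem extends it to the connected open set `ℂ \ {0, -1, -2, …}` (`Gamma_diffEq`), where
it says that `D² log Γ = H₁` for every branch of the logarithm.
-/

/-! ### Polynomials invariant under a shift -/

open MvPolynomial in
/-- The endomorphism of `K[Xᵢ]` that acts on the coefficients by `σ` and sends `Xᵢ` to
`Xᵢ + aᵢ`. -/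
noncomputable def shiftHom {ι K : Type*} [Field K] (σ : K →+* K) (a : ι → K) :
    MvPolynomial ι K →+* MvPolynomial ι K :=
  eval₂Hom (C.comp σ) fun i => X i + C (a i)

namespace shiftHom

open MvPolynomial

variable {ι K : Type*} [Field K] (σ : K →+* K) (a : ι → K)

@[simp]
theorem apply_C (c : K) : shiftHom σ a (C c) = C (σ c) := by simp [shiftHom]

@[simp]
theorem apply_X (i : ι) : shiftHom σ a (X i) = X i + C (a i) := by simp [shiftHom]

/-- Translating the variables and changing the coefficients both commute with differentiation. -/
theorem pderiv_comm (i : ι) (P : MvPolynomial ι K) :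
    pderiv i (shiftHom σ a P) = shiftHom σ a (pderiv i P) := by
  classical
  induction P using MvPolynomial.induction_on with
  | C c => simp
  | add p q hp hq => simp [hp, hq]
  | mul_X p j hp =>
    simp only [map_mul, Derivation.leibniz, apply_X, smul_eq_mul, map_add, hp, pderiv_C, add_zero,
      pderiv_X]
    congr 2
    by_cases h : j = i <;> simp [h]

/-- On a monomial with coefficient one, `shiftHom` only adds terms of lower total degree. -/
theorem coeff_monomial_one_sub (m : ι →₀ ℕ) : ∀ n : ι →₀ ℕ, m.degree ≤ n.degree →
    coeff n (shiftHom σ a (monomial m 1) - monomial m 1) = 0 := by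
  classical
  induction hk : m.degree generalizing m with
  | zero =>
    rw [Finsupp.degree_eq_zero_iff] at hk
    subst hk
    intro n _
    have h1 : (monomial 0 1 : MvPolynomial ι K) = 1 := rfl
    rw [h1, map_one, sub_self, coeff_zero]
  | succ k ih =>
    obtain ⟨i, hi⟩ : ∃ i, m i ≠ 0 := by
      by_contra! h
      have : m = 0 := Finsupp.ext h
      simp [this] at hk
    obtain ⟨m', rfl⟩ : ∃ m', m = Finsupp.single i 1 + m' :=
      ⟨m - Finsupp.single i 1, (add_tsub_cancel_of_le
        (by simpa [Nat.one_le_iff_ne_zero] using hi)).symm⟩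
    have hm' : m'.degree = k := by
      rw [map_add, Finsupp.degree_single] at hk
      omega
    intro n hn
    have hsplit : (monomial (Finsupp.single i 1 + m') 1 : MvPolynomial ι K)
        = X i * monomial m' 1 := by
      rw [X, monomial_mul, one_mul]
    have hexp : shiftHom σ a (X i * monomial m' 1) - X i * monomial m' 1
        = X i * (shiftHom σ a (monomial m' 1) - monomial m' 1)
          + C (a i) * (shiftHom σ a (monomial m' 1) - monomial m' 1)
          + C (a i) * monomial m' 1 := by
      rw [map_mul, apply_X]
      ring
    have hne : m' ≠ n := by
      rintro rfl
      omega
    rw [hsplit, hexp, coeff_add, coeff_add, coeff_C_mul, coeff_C_mul, coeff_monomial,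
      if_neg hne, ih m' hm' n (by omega), coeff_X_mul']
    simp only [mul_zero, add_zero, ite_eq_right_iff]
    intro hin
    refine ih m' hm' _ ?_
    have h1 : n - Finsupp.single i 1 + Finsupp.single i 1 = n :=
      tsub_add_cancel_of_le (by
        simpa [Nat.one_le_iff_ne_zero] using Finsupp.mem_support_iff.1 hin)
    have h2 := congrArg Finsupp.degree h1
    rw [map_add, Finsupp.degree_single] at h2
    omega

/-- In the top degree, `shiftHom` acts on the coefficients only. -/
theorem coeff_of_totalDegree_le {P : MvPolynomial ι K} {n : ι →₀ ℕ}
    (h : P.totalDegree ≤ n.degree) : coeff n (shiftHom σ a P) = σ (coeff n P) := by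
  classical
  have key (m : ι →₀ ℕ) (hm : m ∈ P.support) :
      coeff n (shiftHom σ a (monomial m (coeff m P))) =
        σ (coeff n (monomial m (coeff m P))) := by
    have h1 := coeff_monomial_one_sub σ a m n
      ((le_totalDegree hm).trans h)
    rw [coeff_sub, sub_eq_zero] at h1
    have h2 : monomial m (coeff m P) = C (coeff m P) * monomial m 1 := by
      rw [C_mul_monomial, mul_one]
    rw [h2, map_mul, apply_C, coeff_C_mul, coeff_C_mul, h1, map_mul, coeff_monomial]
    split_ifs <;> simp
  conv_lhs => rw [P.as_sum]
  conv_rhs => rw [P.as_sum]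
  rw [map_sum, coeff_sum, coeff_sum, map_sum]
  exact Finset.sum_congr rfl key

variable [CharZero K]

theorem eq_C_of_pderiv_eq_zero {P : MvPolynomial ι K} (h : ∀ i, pderiv i P = 0) :
    P = C (coeff 0 P) := by
  classical
  ext n
  rw [coeff_C]
  split_ifs with hn
  · rw [hn]
  · obtain ⟨i, hi⟩ := Finsupp.ne_iff.1 (Ne.symm hn)
    have h1 := congrArg (coeff (n - Finsupp.single i 1)) (h i)
    have h2 : n - Finsupp.single i 1 + Finsupp.single i 1 = n :=
      tsub_add_cancel_of_le (by simpa [Nat.one_le_iff_ne_zero] using hi)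
    rw [coeff_pderiv, h2, coeff_zero] at h1
    refine (mul_eq_zero.1 h1).resolve_right ?_
    exact Nat.cast_add_one_ne_zero _

/-- If no nontrivial combination of the `aᵢ` with `σ`-invariant coefficients is of the form
`g - σ g`, then the only polynomials fixed by `shiftHom` are the constants: the partial derivatives
of a fixed polynomial are fixed and have lower degree, so by induction they are constants, and the
polynomial is affine linear. -/
theorem eq_C_of_fixed
    (ha : ∀ (c : ι → K) (s : Finset ι) (g : K), (∀ i, σ (c i) = c i) →
      σ g + ∑ i ∈ s, c i * a i = g → ∀ i ∈ s, c i = 0)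
    {P : MvPolynomial ι K} (hP : shiftHom σ a P = P) : P = C (coeff 0 P) := by
  classical
  -- Induction on a bound for the degrees of the monomials.
  suffices H : ∀ (d : ℕ) (P : MvPolynomial ι K), (∀ n, d < n.degree → coeff n P = 0) →
      shiftHom σ a P = P → P = C (coeff 0 P) from
    H P.totalDegree P (fun n hn => coeff_eq_zero_of_totalDegree_lt hn) hP
  intro d
  induction d with
  | zero =>
    intro P hd _
    ext n
    rw [coeff_C]
    split_ifs with hn
    · rw [hn]
    · exact hd n (Nat.pos_of_ne_zero fun h => hn ((Finsupp.degree_eq_zero_iff n).1 h).symm)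
  | succ d ih =>
    intro P hd hP
    have hder (i : ι) : pderiv i P = C (coeff 0 (pderiv i P)) := by
      refine ih _ (fun n hn => ?_) ?_
      · rw [coeff_pderiv, hd, zero_mul]
        rw [map_add, Finsupp.degree_single]
        omega
      · rw [← pderiv_comm, hP]
    set c : ι → K := fun i => coeff 0 (pderiv i P) with hc
    have hcσ (i : ι) : σ (c i) = c i := by
      have h := pderiv_comm σ a i P
      rw [hP, hder i, apply_C] at h
      exact (C_injective _ _ h).symm
    -- `P` is the sum of a constant `g` and the linear form with the coefficients `c i`.
    have hlin : P - ∑ i ∈ P.vars, C (c i) * X i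
        = C (coeff 0 (P - ∑ i ∈ P.vars, C (c i) * X i)) := by
      refine eq_C_of_pderiv_eq_zero fun j => ?_
      rw [map_sub, map_sum, hder j]
      simp only [Derivation.leibniz, pderiv_C, pderiv_X, smul_eq_mul, mul_zero, add_zero]
      by_cases hj : j ∈ P.vars
      · rw [Finset.sum_eq_single_of_mem j hj fun i _ hij => by simp [hij]]
        simp [hc]
      · rw [Finset.sum_eq_zero fun i hi => by
          have : i ≠ j := fun h => hj (h ▸ hi)
          simp [this]]
        rw [← hder j, pderiv_eq_zero_of_notMem_vars hj, sub_zero]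
    set g := coeff 0 (P - ∑ i ∈ P.vars, C (c i) * X i)
    rw [sub_eq_iff_eq_add] at hlin
    have hg : σ g + ∑ i ∈ P.vars, c i * a i = g := by
      have h1 : shiftHom σ a P = C (σ g) + ∑ i ∈ P.vars, C (c i) * X i
          + C (∑ i ∈ P.vars, c i * a i) := by
        conv_lhs => rw [hlin]
        simp [mul_add, Finset.sum_add_distrib, hcσ, add_assoc]
      rw [hP] at h1
      apply C_injective ι K
      rw [map_add]
      linear_combination hlin - h1
    have hc0 := ha c P.vars g hcσ hg
    have hPg : P = C g := by
      rw [hlin, Finset.sum_eq_zero fun i hi => by rw [hc0 i hi]; simp, add_zero]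
    rw [hPg, coeff_C, if_pos rfl]

/-- Under the hypothesis of `shiftHom.eq_C_of_fixed` a proper ideal that is stable under `shiftHom`
is zero: a nonzero element `P` with the least total degree, with the least number of monomials of
that degree, and with one of their coefficients equal to `1` is fixed by `shiftHom`, since the
difference of `P` and its image is smaller. So `P` is a constant. -/
theorem eq_bot_of_stable
    (ha : ∀ (c : ι → K) (s : Finset ι) (g : K), (∀ i, σ (c i) = c i) →
      σ g + ∑ i ∈ s, c i * a i = g → ∀ i ∈ s, c i = 0)
    {I : Ideal (MvPolynomial ι K)} (hI : I ≠ ⊤) (hs : ∀ P ∈ I, shiftHom σ a P ∈ I) : I = ⊥ := by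
  classical
  by_contra hbot
  have hex : ∃ d, ∃ P ∈ I, P ≠ 0 ∧ P.totalDegree = d := by
    obtain ⟨P, hP, h0⟩ := Submodule.exists_mem_ne_zero_of_ne_bot hbot
    exact ⟨_, P, hP, h0, rfl⟩
  set d := Nat.find hex with hd
  have hmin {P : MvPolynomial ι K} (hP : P ∈ I) (h : ∀ n, d ≤ n.degree → coeff n P = 0) :
      P = 0 := by
    by_contra h0
    refine Nat.find_min hex (m := P.totalDegree) ?_ ⟨P, hP, h0, rfl⟩
    rw [← hd]
    by_contra! hle
    obtain ⟨n, hn, hdeg⟩ := P.support.exists_mem_eq_sup (support_nonempty.2 h0)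
      fun s => s.sum fun _ e => e
    exact mem_support_iff.1 hn (h n (hle.trans hdeg.le))
  let top (P : MvPolynomial ι K) : Finset (ι →₀ ℕ) := P.support.filter fun n => n.degree = d
  have hex2 : ∃ k, ∃ P ∈ I, P ≠ 0 ∧ P.totalDegree = d ∧ (top P).card = k := by
    obtain ⟨P, hP, h0, h1⟩ := Nat.find_spec hex
    exact ⟨_, P, hP, h0, h1, rfl⟩
  obtain ⟨P, hPI, hP0, hPd, hPk⟩ := Nat.find_spec hex2
  have hPtop : (top P).Nonempty := by
    by_contra! hem
    refine hP0 (hmin hPI fun n hn => ?_)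
    by_contra hne
    have h1 : n ∈ P.support := mem_support_iff.2 hne
    have h2 : n.degree ≤ d := (le_totalDegree h1).trans hPd.le
    have : n ∈ top P := Finset.mem_filter.2 ⟨h1, le_antisymm h2 hn⟩
    simp [hem] at this
  obtain ⟨m, hm⟩ := hPtop
  obtain ⟨hmP, hmd⟩ := Finset.mem_filter.1 hm
  set u := coeff m P with hu
  have hu0 : u ≠ 0 := mem_support_iff.1 hmP
  set Q := C u⁻¹ * P with hQ
  have hQI : Q ∈ I := I.mul_mem_left _ hPI
  have hQ0 : Q ≠ 0 := mul_ne_zero (by simpa using hu0) hP0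
  have hQd {n : ι →₀ ℕ} (hn : d < n.degree) : coeff n Q = 0 := by
    rw [hQ, coeff_C_mul, coeff_eq_zero_of_totalDegree_lt (by rw [hPd]; exact hn), mul_zero]
  have hQdeg : Q.totalDegree ≤ d := by
    refine (totalDegree_mul _ _).trans ?_
    rw [totalDegree_C, zero_add, hPd]
  have hdiff {n : ι →₀ ℕ} (hn : d ≤ n.degree) :
      coeff n (shiftHom σ a Q - Q) = σ (coeff n Q) - coeff n Q := by
    rw [coeff_sub, coeff_of_totalDegree_le σ a (hQdeg.trans hn)]
  have hfix : shiftHom σ a Q = Q := by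
    by_contra hne
    have hR0 : shiftHom σ a Q - Q ≠ 0 := sub_ne_zero.2 hne
    have hRI : shiftHom σ a Q - Q ∈ I := I.sub_mem (hs Q hQI) hQI
    have hRd : (shiftHom σ a Q - Q).totalDegree ≤ d := by
      refine Finset.sup_le fun n hn => ?_
      by_contra! hlt
      replace hlt : d < n.degree := hlt
      refine mem_support_iff.1 hn ?_
      rw [hdiff hlt.le, hQd hlt, map_zero, sub_zero]
    have hRd' : d ≤ (shiftHom σ a Q - Q).totalDegree := Nat.find_min' hex ⟨_, hRI, hR0, rfl⟩
    refine Nat.find_min hex2 (m := (top (shiftHom σ a Q - Q)).card) ?_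
      ⟨_, hRI, hR0, le_antisymm hRd hRd', rfl⟩
    rw [← hPk]
    refine Finset.card_lt_card (Finset.ssubset_iff_subset_ne.2 ⟨fun n hn => ?_, fun h => ?_⟩)
    · obtain ⟨h1, h2⟩ := Finset.mem_filter.1 hn
      refine Finset.mem_filter.2 ⟨mem_support_iff.2 fun h0 => mem_support_iff.1 h1 ?_, h2⟩
      rw [hdiff h2.ge, hQ, coeff_C_mul, h0]
      simp
    · rw [← h] at hm
      refine mem_support_iff.1 (Finset.mem_filter.1 hm).1 ?_
      rw [hdiff hmd.ge, hQ, coeff_C_mul, ← hu, inv_mul_cancel₀ hu0]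
      simp
  have hQC := eq_C_of_fixed σ a ha hfix
  refine hI (I.eq_top_of_isUnit_mem hQI ?_)
  rw [hQC]
  refine (isUnit_iff_ne_zero.2 fun h => hQ0 ?_).map C
  rw [hQC, h, C_0]

end shiftHom

/-! ### Shift equations for rational functions -/

/-- The substitution `r(z) ↦ r(z + 1)` on the field `ℂ(z)`. -/
noncomputable def ratShift : RatFunc ℂ →+* RatFunc ℂ :=
  RatFunc.mapRingHom (Polynomial.taylorAlgHom (1 : ℂ))
    (nonZeroDivisors_le_comap_nonZeroDivisors_of_injective _ (Polynomial.taylor_injective 1))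

namespace ratShift

open Polynomial

theorem apply (r : RatFunc ℂ) : ratShift r =
    algebraMap ℂ[X] (RatFunc ℂ) (taylor 1 r.num) / algebraMap ℂ[X] (RatFunc ℂ) (taylor 1 r.denom) :=
  RatFunc.map_apply (Polynomial.taylorAlgHom (1 : ℂ))
    (nonZeroDivisors_le_comap_nonZeroDivisors_of_injective _ (Polynomial.taylor_injective 1)) r

theorem apply_algebraMap (p : ℂ[X]) :
    ratShift (algebraMap ℂ[X] (RatFunc ℂ) p) = algebraMap ℂ[X] (RatFunc ℂ) (taylor 1 p) := by
  rw [apply]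
  simp

theorem eval_num_denom_ne_zero (r : RatFunc ℂ) (z : ℂ) (h : r.denom.eval z = 0) :
    r.num.eval z ≠ 0 := by
  obtain ⟨u, v, huv⟩ := RatFunc.isCoprime_num_denom r
  intro h0
  have := congrArg (Polynomial.eval z) huv
  simp [h, h0] at this

/-- A polynomial whose set of roots contains a full orbit `z, z + 1, z + 2, …` is zero. -/
theorem eq_zero_of_roots_orbit {p : ℂ[X]} {z : ℂ} (h : ∀ n : ℕ, p.eval (z + n) = 0) : p = 0 := by
  refine Polynomial.eq_zero_of_infinite_isRoot p
    ((Set.infinite_range_of_injective (f := fun n : ℕ => z + n) fun m n hmn => ?_).mono ?_)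
  · simpa using hmn
  · rintro _ ⟨n, rfl⟩
    exact h n

/-- The rational functions with period `1` are the constants. -/
theorem eq_C_of_fixed {r : RatFunc ℂ} (hr : ratShift r = r) : ∃ k : ℂ, r = RatFunc.C k := by
  have hd0 : r.denom ≠ 0 := r.denom_ne_zero
  have hrel : taylor 1 r.num * r.denom = r.num * taylor 1 r.denom := by
    rw [apply] at hr
    nth_rw 3 [← r.num_div_denom] at hr
    rw [div_eq_div_iff (by simpa using hd0) (by simpa using hd0), ← map_mul, ← map_mul] at hr
    exact RatFunc.algebraMap_injective ℂ hr
  -- The roots of the denominator are stable under `z ↦ z + 1`, so there are none.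
  have hstep (z : ℂ) (hz : r.denom.eval z = 0) : r.denom.eval (z + 1) = 0 := by
    have h := congrArg (Polynomial.eval z) hrel
    simp only [eval_mul, taylor_eval, hz, mul_zero] at h
    exact (mul_eq_zero.1 h.symm).resolve_left (eval_num_denom_ne_zero r z hz)
  have hdeg : r.denom = 1 := by
    by_contra hne
    have hdeg : r.denom.degree ≠ 0 := fun h =>
      hne (eq_one_of_monic_natDegree_zero r.monic_denom (natDegree_eq_of_degree_eq_some h))
    obtain ⟨z, hz⟩ := IsAlgClosed.exists_root r.denom hdeg
    refine hd0 (eq_zero_of_roots_orbit (z := z) fun n => ?_)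
    induction n with
    | zero => simpa using hz
    | succ n ih =>
      rw [Nat.cast_succ, ← add_assoc]
      exact hstep _ ih
  have hper (z : ℂ) : r.num.eval (z + 1) = r.num.eval z := by
    have h := congrArg (Polynomial.eval z) hrel
    simpa [hdeg, taylor_eval] using h
  have hconst : r.num - Polynomial.C (r.num.eval 0) = 0 := by
    refine eq_zero_of_roots_orbit (z := 0) fun n => ?_
    induction n with
    | zero => simp
    | succ n ih =>
      simp only [zero_add, eval_sub, eval_C] at ih ⊢
      rwa [Nat.cast_succ, hper]
  refine ⟨r.num.eval 0, ?_⟩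
  rw [← RatFunc.algebraMap_C, ← sub_eq_zero.1 hconst]
  conv_lhs => rw [← r.num_div_denom, hdeg, map_one, div_one]

/-- A rational function with a pole at `0` and no other poles is not of the form `g z - g (z + 1)`.
Here it is `Q z / z ^ N` with `Q 0 ≠ 0`. If `g` has no poles at integers then neither has the
difference. Otherwise let `m` and `M` be the least and the greatest of these poles; then `M` and
`m - 1` are both poles of the difference. -/
theorem ne_of_pole_at_zero {N : ℕ} (hN : N ≠ 0) {Q : ℂ[X]} (hQ : Q.eval 0 ≠ 0) (g : RatFunc ℂ) :
    ratShift g + algebraMap ℂ[X] (RatFunc ℂ) Q / RatFunc.X ^ N ≠ g := by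
  intro hg
  have hd0 : g.denom ≠ 0 := g.denom_ne_zero
  have hrel : taylor 1 g.num * g.denom * X ^ N + Q * g.denom * taylor 1 g.denom
      = g.num * taylor 1 g.denom * X ^ N := by
    apply RatFunc.algebraMap_injective ℂ
    have h1 : algebraMap ℂ[X] (RatFunc ℂ) g.denom ≠ 0 := by simpa using hd0
    have h2 : algebraMap ℂ[X] (RatFunc ℂ) (taylor 1 g.denom) ≠ 0 := by simpa using hd0
    have h3 : (RatFunc.X : RatFunc ℂ) ≠ 0 := RatFunc.X_ne_zero
    rw [apply] at hg
    nth_rw 3 [← g.num_div_denom] at hg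
    field_simp at hg
    simp only [map_add, map_mul, map_pow, RatFunc.algebraMap_X]
    linear_combination hg
  have hev (z : ℂ) : g.num.eval (z + 1) * g.denom.eval z * z ^ N
      + Q.eval z * g.denom.eval z * g.denom.eval (z + 1)
      = g.num.eval z * g.denom.eval (z + 1) * z ^ N := by
    have h := congrArg (Polynomial.eval z) hrel
    simpa [taylor_eval] using h
  have hfin : {k : ℤ | g.denom.eval (k : ℂ) = 0}.Finite :=
    (Polynomial.finite_setOfPred_isRoot hd0).preimage (Int.cast_injective.injOn)
  rcases {k : ℤ | g.denom.eval (k : ℂ) = 0}.eq_empty_or_nonempty with hem | hne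
  · have hno (k : ℤ) : g.denom.eval (k : ℂ) ≠ 0 := fun h => by
      have : k ∈ {k : ℤ | g.denom.eval (k : ℂ) = 0} := h
      simp [hem] at this
    have h := hev 0
    have h0 := hno 0
    have h1 := hno 1
    simp only [Int.cast_zero, Int.cast_one] at h0 h1
    simp [hN, hQ, h0, h1] at h
  · obtain ⟨M, hM, hMmax⟩ := hfin.exists_maximal hne
    obtain ⟨m, hm, hmmin⟩ := hfin.exists_minimal hne
    have hM1 : g.denom.eval ((M : ℂ) + 1) ≠ 0 := fun h => by
      have := @hMmax (M + 1) (by simpa using h) (by simp)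
      simp at this
    have hm1 : g.denom.eval ((m : ℂ) - 1) ≠ 0 := fun h => by
      have := @hmmin (m - 1) (by simpa using h) (by simp)
      simp at this
    have hM' : g.denom.eval (M : ℂ) = 0 := hM
    have hm' : g.denom.eval (m : ℂ) = 0 := hm
    have hMm : m ≤ M := by
      rcases le_total m M with h | h
      · exact h
      · exact hMmax hm h
    -- The relation at `M` forces `M = 0`, and at `m - 1` it forces `m = 1`.
    have e1 := hev M
    have e2 := hev ((m : ℂ) - 1)
    rw [sub_add_cancel] at e2
    simp only [hM', hm', mul_zero, zero_mul, add_zero, zero_eq_mul, mul_eq_zero, hM1, hm1,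
      pow_eq_zero_iff hN, eval_num_denom_ne_zero g _ hM', eval_num_denom_ne_zero g _ hm',
      false_or] at e1 e2
    have e1' : M = 0 := by exact_mod_cast e1
    have e2' : m = 1 := by exact_mod_cast sub_eq_zero.1 e2
    omega

/-- The shift equation `g z - g (z + 1) = ∑ i, cᵢ αᵢ / z ^ (i + 2)` with periodic `cᵢ` and nonzero
constants `αᵢ` is only solvable for `cᵢ = 0`. -/
theorem eq_zero_of_sum_poles {α : ℕ → ℂ} (hα : ∀ i, α i ≠ 0) (c : ℕ → RatFunc ℂ) (s : Finset ℕ)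
    (g : RatFunc ℂ) (hc : ∀ i, ratShift (c i) = c i)
    (hg : ratShift g + ∑ i ∈ s, c i * (RatFunc.C (α i) / RatFunc.X ^ (i + 2)) = g) :
    ∀ i ∈ s, c i = 0 := by
  choose k hk using fun i => eq_C_of_fixed (hc i)
  by_contra! hex
  obtain ⟨j, hj, hj0⟩ := hex
  have hne : (s.filter fun i => k i ≠ 0).Nonempty :=
    ⟨j, Finset.mem_filter.2 ⟨hj, fun h => hj0 (by rw [hk, h, map_zero])⟩⟩
  -- The term with the largest index determines the order `n + 2` of the pole at `0`.
  set n := (s.filter fun i => k i ≠ 0).max' hne with hn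
  have hmem : n ∈ s.filter fun i => k i ≠ 0 := Finset.max'_mem _ hne
  set Q : ℂ[X] := ∑ i ∈ s.filter (fun i => k i ≠ 0), Polynomial.C (k i * α i) * X ^ (n - i)
    with hQ
  have hQ0 : Q.eval 0 ≠ 0 := by
    rw [hQ, eval_finsetSum, Finset.sum_eq_single_of_mem n hmem]
    · simpa using ⟨(Finset.mem_filter.1 hmem).2, hα n⟩
    · intro i hi hin
      have : i < n := lt_of_le_of_ne (Finset.le_max' _ _ hi) hin
      simp [Nat.sub_ne_zero_of_lt this]
  refine ne_of_pole_at_zero (N := n + 2) (by simp) hQ0 g ?_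
  rw [← Finset.sum_filter_add_sum_filter_not s (fun i => k i ≠ 0),
    Finset.sum_eq_zero (s := s.filter fun i => ¬ k i ≠ 0), add_zero] at hg
  · convert hg using 2
    rw [hQ, map_sum, Finset.sum_div]
    refine Finset.sum_congr rfl fun i hi => ?_
    have hin : i ≤ n := Finset.le_max' _ _ hi
    have hX : (RatFunc.X : RatFunc ℂ) ≠ 0 := RatFunc.X_ne_zero
    rw [hk i, map_mul, map_pow, RatFunc.algebraMap_X, RatFunc.algebraMap_C, map_mul,
      show n + 2 = (n - i) + (i + 2) by omega, pow_add]
    field_simp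
  · intro i hi
    have : k i = 0 := by simpa using (Finset.mem_filter.1 hi).2
    rw [hk i, this, map_zero, zero_mul]

end ratShift

/-! ### The function `H₁` -/

section HOne

open Filter Topology

theorem summable_one_div_add_sq (z : ℂ) : Summable fun n : ℕ => 1 / ((n : ℂ) + z) ^ 2 := by
  refine Summable.of_norm_bounded_eventually_nat (g := fun n : ℕ => 4 * (1 / (n : ℝ) ^ 2))
    ((Real.summable_one_div_nat_pow.2 one_lt_two).mul_left 4) ?_
  obtain ⟨N, hN⟩ := exists_nat_ge (2 * ‖z‖)
  filter_upwards [eventually_ge_atTop (N + 1)] with n hn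
  have hn' : (N : ℝ) + 1 ≤ n := by exact_mod_cast hn
  have hpos : (0 : ℝ) < n / 2 := by
    have : (0 : ℝ) ≤ N := N.cast_nonneg
    linarith
  have h1 : (n : ℝ) / 2 ≤ ‖(n : ℂ) + z‖ := by
    have h2 := norm_sub_le_norm_add (n : ℂ) z
    rw [Complex.norm_natCast] at h2
    linarith
  calc ‖1 / ((n : ℂ) + z) ^ 2‖ = 1 / ‖(n : ℂ) + z‖ ^ 2 := by rw [norm_div, norm_one, norm_pow]
    _ ≤ 1 / ((n : ℝ) / 2) ^ 2 := by gcongr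
    _ = 4 * (1 / (n : ℝ) ^ 2) := by ring

/-- This holds at the poles too, where the junk value of the term `1 / 0 ^ 2` is `0`. -/
theorem hOne_eq_add (z : ℂ) : hOne z = 1 / z ^ 2 + hOne (z + 1) := by
  rw [hOne, (summable_one_div_add_sq z).tsum_eq_zero_add, hOne]
  congr 1
  · simp
  · refine tsum_congr fun n => ?_
    rw [Nat.cast_succ, add_assoc, add_comm 1 z]

/-- Shifting the argument removes the term `1 / z ^ 2`, which is unbounded on the half plane; the
others are dominated by `1 / (n + 1) ^ 2`. -/
theorem differentiableOn_hOne_add_one :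
    DifferentiableOn ℂ (fun z => hOne (z + 1)) {z | 0 < z.re} := by
  unfold hOne
  have hne (n : ℕ) (w : ℂ) (hw : w ∈ {z : ℂ | 0 < z.re}) : (n : ℝ) + 1 ≤ ‖(n : ℂ) + (w + 1)‖ := by
    refine le_trans ?_ (Complex.re_le_norm _)
    have : 0 < w.re := hw
    simp
    linarith
  refine Complex.differentiableOn_tsum_of_summable_norm (u := fun n : ℕ => 1 / ((n : ℝ) + 1) ^ 2) ?_
    (fun n w hw => ?_) (isOpen_lt continuous_const Complex.continuous_re) fun n w hw => ?_
  · simpa using (summable_nat_add_iff 1).2 (Real.summable_one_div_nat_pow.2 one_lt_two)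
  · have h0 : (n : ℂ) + (w + 1) ≠ 0 := by
      rw [← norm_pos_iff]
      exact lt_of_lt_of_le (by positivity) (hne n w hw)
    fun_prop (disch := simpa using h0)
  · rw [norm_div, norm_one, norm_pow]
    gcongr
    exact hne n w hw

theorem analyticAt_hOne_of_re_pos {z : ℂ} (hz : 0 < z.re) : AnalyticAt ℂ hOne z := by
  have hopen : IsOpen {z : ℂ | 0 < z.re} := isOpen_lt continuous_const Complex.continuous_re
  refine DifferentiableOn.analyticAt (s := {z : ℂ | 0 < z.re}) (fun w hw => ?_)
    (hopen.mem_nhds hz)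
  have hw0 : w ≠ 0 := fun h => by simp [h] at hw
  have h1 : DifferentiableWithinAt ℂ (fun w : ℂ => 1 / w ^ 2 + hOne (w + 1)) {z | 0 < z.re} w :=
    DifferentiableWithinAt.add (by fun_prop (disch := simpa using hw0))
      (differentiableOn_hOne_add_one w hw)
  rwa [← funext hOne_eq_add] at h1

theorem analyticAt_hOne {z : ℂ} (hz : ∀ m : ℕ, z ≠ -(m : ℂ)) : AnalyticAt ℂ hOne z := by
  obtain ⟨N, hN⟩ := exists_nat_gt (-z.re)
  induction N generalizing z with
  | zero => exact analyticAt_hOne_of_re_pos (by simpa using hN)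
  | succ N ih =>
    have h1 : AnalyticAt ℂ hOne (z + 1) := by
      refine ih (fun m h => hz (m + 1) ?_) ?_
      · push_cast
        linear_combination h
      · push_cast at hN
        simp
        linarith
    have h0 : z ≠ 0 := by simpa using hz 0
    have h2 : AnalyticAt ℂ (fun w => hOne (w + 1)) z :=
      h1.comp_of_eq (f := fun w : ℂ => w + 1) (by fun_prop) rfl
    rw [funext hOne_eq_add]
    exact AnalyticAt.add (by fun_prop (disch := simpa using h0)) h2

theorem meromorphic_hOne : Meromorphic hOne := by
  intro z
  obtain ⟨N, hN⟩ := exists_nat_gt (-z.re)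
  induction N generalizing z with
  | zero => exact (analyticAt_hOne_of_re_pos (by simpa using hN)).meromorphicAt
  | succ N ih =>
    have h1 : MeromorphicAt hOne (z + 1) := by
      refine ih (z + 1) ?_
      push_cast at hN
      simp
      linarith
    have h2 : MeromorphicAt (fun w => hOne (w + 1)) z := by
      refine MeromorphicAt.comp_analyticAt (f := hOne) (g := fun w : ℂ => w + 1) h1 (by fun_prop)
    rw [funext hOne_eq_add]
    exact MeromorphicAt.add (by fun_prop) h2

/-- The constants `αᵢ` in `Dⁱ H₁ (z + 1) = Dⁱ H₁ z + αᵢ / z ^ (i + 2)`. -/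
noncomputable def shiftCoeff (i : ℕ) : ℂ := -∏ j ∈ Finset.range i, (-2 - j : ℂ)

theorem shiftCoeff_ne_zero (i : ℕ) : shiftCoeff i ≠ 0 := by
  refine neg_ne_zero.2 (Finset.prod_ne_zero_iff.2 fun j _ h => ?_)
  have h1 : ((j + 2 : ℕ) : ℂ) = 0 := by
    push_cast
    linear_combination -h
  exact absurd (Nat.cast_eq_zero.1 h1) (by omega)

theorem iteratedDeriv_hOne_add_one (i : ℕ) {z : ℂ} (h0 : z ≠ 0) (hz : AnalyticAt ℂ hOne z) :
    iteratedDeriv i hOne (z + 1) = shiftCoeff i / z ^ (i + 2) + iteratedDeriv i hOne z := by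
  have hfun : (fun w => hOne (w + 1)) = fun w => hOne w - w ^ (-2 : ℤ) := by
    ext w
    rw [hOne_eq_add w, zpow_neg, one_div]
    norm_cast
    ring
  have h1 : iteratedDeriv i hOne (z + 1) = iteratedDeriv i (fun w => hOne (w + 1)) z := by
    rw [iteratedDeriv_comp_add_const]
  have h2 : AnalyticAt ℂ (fun w : ℂ => w ^ (-2 : ℤ)) z := analyticAt_id.zpow h0
  rw [h1, hfun, iteratedDeriv_fun_sub hz.contDiffAt h2.contDiffAt,
    iteratedDeriv_eq_iterate (f := fun w : ℂ => w ^ (-2 : ℤ)), iter_deriv_zpow, shiftCoeff,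
    show (-2 : ℤ) - i = -((i + 2 : ℕ) : ℤ) by push_cast; ring, zpow_neg, zpow_natCast]
  push_cast
  ring

end HOne

/-! ### Germs and differential transcendence -/

section Germs

open Filter Topology

/-- Translation by `1` is compatible with the filter of codiscrete sets. -/
theorem tendsto_add_one_codiscrete :
    Tendsto (fun z : ℂ => z + 1) (codiscrete ℂ) (codiscrete ℂ) := by
  intro s hs
  rw [mem_codiscrete] at hs
  rw [Filter.mem_map, mem_codiscrete]
  intro z
  have h := hs (z + 1)
  rw [disjoint_principal_right, compl_compl] at h ⊢
  have ht : Tendsto (fun z : ℂ => z + 1) (𝓝[≠] z) (𝓝[≠] (z + 1)) := by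
    refine tendsto_nhdsWithin_of_tendsto_nhds_of_eventually_within _ ?_ ?_
    · exact ((continuous_add_const (1 : ℂ)).tendsto z).mono_left nhdsWithin_le_nhds
    · filter_upwards [self_mem_nhdsWithin] with w hw
      simpa using hw
  exact ht h

instance codiscrete_complex_neBot : (codiscrete ℂ).NeBot := by
  refine ⟨fun h => ?_⟩
  have h1 : (∅ : Set ℂ) ∈ codiscrete ℂ := by simp [h]
  rw [mem_codiscrete] at h1
  have h2 : 𝓝[≠] (0 : ℂ) = ⊥ := by simpa using h1 0
  exact (inferInstance : (𝓝[≠] (0 : ℂ)).NeBot).ne h2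

/-- The ring of germs of functions off closed discrete subsets of `ℂ`. It contains the field of
meromorphic functions on `ℂ`. -/
abbrev MerGerm : Type := (codiscrete ℂ).Germ ℂ

theorem eventually_denom_eval_ne_zero (r : RatFunc ℂ) :
    ∀ᶠ z in codiscrete ℂ, r.denom.eval₂ (RingHom.id ℂ) z ≠ 0 := by
  have h := (Polynomial.finite_setOfPred_isRoot r.denom_ne_zero).compl_mem_codiscrete
  filter_upwards [h] with z hz
  simpa [Polynomial.eval₂_id] using hz

/-- The embedding of `ℂ(z)` into germs. It is a ring homomorphism because the junk values of
`RatFunc.eval` at the poles do not affect the germ. -/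
noncomputable def ratGerm : RatFunc ℂ →+* MerGerm where
  toFun r := ((fun z => r.eval (RingHom.id ℂ) z : ℂ → ℂ) : MerGerm)
  map_one' := by
    simp only [RatFunc.eval_one]
    rfl
  map_zero' := by
    simp only [RatFunc.eval_zero]
    rfl
  map_mul' r s := by
    rw [← Germ.coe_mul]
    refine Germ.coe_eq.2 ?_
    filter_upwards [eventually_denom_eval_ne_zero r, eventually_denom_eval_ne_zero s] with z hr hs
    exact RatFunc.eval_mul _ _ hr hs
  map_add' r s := by
    rw [← Germ.coe_add]
    refine Germ.coe_eq.2 ?_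
    filter_upwards [eventually_denom_eval_ne_zero r, eventually_denom_eval_ne_zero s] with z hr hs
    exact RatFunc.eval_add _ _ hr hs

theorem eventually_codiscrete_ne_zero : ∀ᶠ z in codiscrete ℂ, z ≠ 0 :=
  (Set.finite_singleton (0 : ℂ)).compl_mem_codiscrete

theorem ratGerm_C_div_X_pow (c : ℂ) (n : ℕ) :
    ratGerm (RatFunc.C c / RatFunc.X ^ n) = ((fun z => c / z ^ n : ℂ → ℂ) : MerGerm) := by
  have hX : ratGerm (RatFunc.X ^ n) = ((fun z => z ^ n : ℂ → ℂ) : MerGerm) := by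
    rw [map_pow]
    refine congrArg (fun f : ℂ → ℂ => (f : MerGerm) ^ n) (funext fun z => ?_)
    simp
  have hC : ratGerm (RatFunc.C c) = ((fun _ => c : ℂ → ℂ) : MerGerm) :=
    congrArg (Germ.ofFun (l := codiscrete ℂ)) (funext fun z => by simp)
  have h : ratGerm (RatFunc.C c / RatFunc.X ^ n) * ratGerm (RatFunc.X ^ n)
      = ratGerm (RatFunc.C c) := by
    rw [← map_mul, div_mul_cancel₀ _ (pow_ne_zero _ RatFunc.X_ne_zero)]
  rw [hX, hC] at h
  refine Germ.coe_eq.2 ?_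
  filter_upwards [Germ.coe_eq.1 h, eventually_codiscrete_ne_zero] with z hz h0
  exact (eq_div_iff (pow_ne_zero n h0)).2 hz

/-- The translation `f ↦ f (· + 1)` of germs. -/
noncomputable def germShift : MerGerm →+* MerGerm where
  toFun f := f.compTendsto (fun z => z + 1) tendsto_add_one_codiscrete
  map_one' := rfl
  map_zero' := rfl
  map_mul' f g := by
    induction f, g using Germ.inductionOn₂ with | _ f g => rfl
  map_add' f g := by
    induction f, g using Germ.inductionOn₂ with | _ f g => rfl

theorem germShift_coe (f : ℂ → ℂ) :
    germShift (f : MerGerm) = ((fun z => f (z + 1) : ℂ → ℂ) : MerGerm) := rfl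

theorem germShift_ratGerm (r : RatFunc ℂ) : germShift (ratGerm r) = ratGerm (ratShift r) := by
  suffices h : germShift.comp ratGerm = ratGerm.comp ratShift from RingHom.congr_fun h r
  refine IsLocalization.ringHom_ext (nonZeroDivisors (Polynomial ℂ)) (RingHom.ext fun p => ?_)
  simp only [RingHom.comp_apply, ratShift.apply_algebraMap]
  refine congrArg (Germ.ofFun (l := codiscrete ℂ)) (funext fun z => ?_)
  simp [RatFunc.eval_algebraMap, Polynomial.eval₂_id, Polynomial.taylor_eval]

/-- The ring homomorphism `P ↦ P(f, Df, D²f, …)` from differential polynomials to germs. -/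
noncomputable def diffEval (f : ℂ → ℂ) : DiffPoly →+* MerGerm :=
  MvPolynomial.eval₂Hom ratGerm fun i => ((iteratedDeriv i f : ℂ → ℂ) : MerGerm)

theorem diffEval_apply (f : ℂ → ℂ) (P : DiffPoly) :
    diffEval f P = ((P.evalAt f : ℂ → ℂ) : MerGerm) := by
  have hcoe (h : ℂ → ℂ) : (h : MerGerm) = Germ.coeRingHom (codiscrete ℂ) h := rfl
  have hr (r : RatFunc ℂ) : ratGerm r
    = Germ.coeRingHom (codiscrete ℂ) (fun z => r.eval (RingHom.id ℂ) z) := rfl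
  rw [diffEval, MvPolynomial.coe_eval₂Hom, MvPolynomial.eval₂_eq]
  simp only [hcoe, hr, ← map_pow, ← map_prod, ← map_mul, ← map_sum]
  congr 1
  ext z
  simp [DiffPoly.evalAt, Finset.sum_apply, Finset.prod_apply]

/-- Translating `P(H₁, DH₁, …)` by `1` amounts to applying `shiftHom` to `P`. So the ideal of
differential relations of `H₁` is stable under `shiftHom`. -/
theorem diffEval_shiftHom (P : DiffPoly) :
    diffEval hOne (shiftHom ratShift
      (fun i => RatFunc.C (shiftCoeff i) / RatFunc.X ^ (i + 2)) P) =
        germShift (diffEval hOne P) := by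
  suffices h : (diffEval hOne).comp (shiftHom ratShift
      fun i => RatFunc.C (shiftCoeff i) / RatFunc.X ^ (i + 2)) = germShift.comp (diffEval hOne) from
    RingHom.congr_fun h P
  refine MvPolynomial.ringHom_ext (fun r => ?_) fun i => ?_
  · simp [diffEval, germShift_ratGerm]
  · simp only [diffEval, RingHom.comp_apply, shiftHom.apply_X, map_add,
      MvPolynomial.coe_eval₂Hom, MvPolynomial.eval₂_X, MvPolynomial.eval₂_C, germShift_coe]
    rw [ratGerm_C_div_X_pow, ← Germ.coe_add]
    refine Germ.coe_eq.2 ?_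
    filter_upwards [eventually_codiscrete_ne_zero,
      meromorphic_hOne.meromorphicOn.analyticAt_mem_codiscreteWithin] with z h0 hz
    rw [iteratedDeriv_hOne_add_one i h0 hz, add_comm]
    rfl

theorem isDifferentiallyTranscendental_hOne : IsDifferentiallyTranscendental hOne := by
  refine ⟨meromorphic_hOne, ?_⟩
  rintro ⟨P, hP0, hP⟩
  have hbot := shiftHom.eq_bot_of_stable (K := RatFunc ℂ) ratShift
    (fun i => RatFunc.C (shiftCoeff i) / RatFunc.X ^ (i + 2))
    (ratShift.eq_zero_of_sum_poles shiftCoeff_ne_zero)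
    (I := RingHom.ker (diffEval hOne)) (RingHom.ker_ne_top _) fun Q hQ => by
      rw [RingHom.mem_ker] at hQ ⊢
      rw [diffEval_shiftHom, hQ, map_zero]
  refine hP0 ?_
  rw [← Ideal.mem_bot, ← hbot, RingHom.mem_ker, diffEval_apply]
  exact Germ.coe_eq.2 hP

end Germs

/-! ### The Gamma function -/

section Gamma

open Filter Topology MeasureTheory Complex Metric

/-- A bounded sequence of holomorphic functions on a disc that converges pointwise on the boundary
circle to a holomorphic function has convergent derivatives at the centre: apply dominated
convergence to the Cauchy integrals. -/
theorem tendsto_iteratedDeriv_of_bounded {F : ℕ → ℂ → ℂ} {f : ℂ → ℂ} {c : ℂ} {R C : ℝ} (hR : 0 < R)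
    (hF : ∀ᶠ n in atTop, DifferentiableOn ℂ (F n) (closedBall c R))
    (hf : DifferentiableOn ℂ f (closedBall c R))
    (hC : ∀ᶠ n in atTop, ∀ z ∈ sphere c R, ‖F n z‖ ≤ C)
    (hlim : ∀ z ∈ sphere c R, Tendsto (fun n => F n z) atTop (𝓝 (f z))) (k : ℕ) :
    Tendsto (fun n => iteratedDeriv k (F n) c) atTop (𝓝 (iteratedDeriv k f c)) := by
  have hcauchy (g : ℂ → ℂ) (hg : DifferentiableOn ℂ g (closedBall c R)) :
      iteratedDeriv k g c = (2 * Real.pi * I / k.factorial)⁻¹ *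
        ∮ z in C(c, R), (1 / (z - c) ^ (k + 1)) • g z := by
    rw [hg.circleIntegral_one_div_sub_center_pow_smul hR k, smul_eq_mul, inv_mul_cancel_left₀]
    exact div_ne_zero two_pi_I_ne_zero (by exact_mod_cast k.factorial_ne_zero)
  rw [hcauchy f hf]
  refine Tendsto.congr' (f₁ := fun n => (2 * Real.pi * I / k.factorial)⁻¹ *
        ∮ z in C(c, R), (1 / (z - c) ^ (k + 1)) • F n z) ?_ ?_
  · filter_upwards [hF] with n hn
    rw [hcauchy _ hn]
  refine Tendsto.const_mul _ ?_
  unfold circleIntegral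
  have hmem (θ : ℝ) : circleMap c R θ ∈ sphere c R := circleMap_mem_sphere c hR.le θ
  have hne (θ : ℝ) : circleMap c R θ - c ≠ 0 := by
    rw [sub_ne_zero]
    exact circleMap_ne_center hR.ne'
  refine intervalIntegral.tendsto_integral_filter_of_dominated_convergence
    (fun _ => R * (1 / R ^ (k + 1) * C)) ?_ ?_ (by simp) ?_
  · filter_upwards [hF] with n hn
    have h1 : Continuous fun θ => F n (circleMap c R θ) :=
      hn.continuousOn.comp_continuous (continuous_circleMap c R)
        fun θ => sphere_subset_closedBall (hmem θ)
    have h2 : Continuous fun θ => 1 / (circleMap c R θ - c) ^ (k + 1) :=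
      continuous_const.div (by fun_prop) fun θ => pow_ne_zero _ (hne θ)
    have h3 : Continuous (deriv (circleMap c R)) := by
      have : deriv (circleMap c R) = fun θ => circleMap 0 R θ * I :=
        funext (deriv_circleMap c R)
      rw [this]
      fun_prop
    exact (h3.smul (h2.smul h1)).aestronglyMeasurable
  · filter_upwards [hC] with n hn
    refine ae_of_all _ fun θ _ => ?_
    have h1 : ‖circleMap c R θ - c‖ = R := by simpa using (mem_sphere_iff_norm.1 (hmem θ))
    rw [norm_smul, norm_smul, norm_div, norm_one, norm_pow, h1, deriv_circleMap, norm_mul, norm_I,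
      mul_one, norm_circleMap_zero, abs_of_pos hR]
    gcongr
    exact hn _ (hmem θ)
  · exact ae_of_all _ fun θ _ => ((hlim _ (hmem θ)).const_smul _).const_smul _

/-- Euler's approximations of the Gamma function are bounded by the Gamma integral on the right half
plane. -/
theorem norm_GammaSeq_le {s : ℂ} (hs : 0 < s.re) {n : ℕ} (hn : n ≠ 0) :
    ‖GammaSeq s n‖ ≤ Real.Gamma s.re := by
  rw [GammaSeq_eq_approx_Gamma_integral hs hn, Real.Gamma_eq_integral hs,
    intervalIntegral.integral_of_le (by positivity)]
  have hint := Real.GammaIntegral_convergent hs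
  refine (norm_integral_le_of_norm_le (hint.mono_set Set.Ioc_subset_Ioi_self) ?_).trans
    (setIntegral_mono_set hint ?_ (ae_of_all _ Set.Ioc_subset_Ioi_self))
  · refine (ae_restrict_iff' measurableSet_Ioc).2 (ae_of_all _ fun x hx => ?_)
    rw [norm_mul, Complex.norm_of_nonneg (pow_nonneg (sub_nonneg.2 (div_le_one_of_le₀ hx.2
      (by positivity))) _), norm_cpow_eq_rpow_re_of_pos hx.1, sub_re, one_re]
    exact mul_le_mul_of_nonneg_right (Real.one_sub_div_pow_le_exp_neg hx.2)
      (Real.rpow_nonneg hx.1.le _)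
  · refine (ae_restrict_iff' measurableSet_Ioi).2 (ae_of_all _ fun x hx => ?_)
    have : (0 : ℝ) < x := hx
    simp only [Pi.zero_apply]
    positivity

theorem add_natCast_ne_zero_of_re_pos {s : ℂ} (hs : 0 < s.re) (j : ℕ) : s + j ≠ 0 := by
  intro h
  have := congrArg re h
  simp at this
  have : (0 : ℝ) ≤ j := j.cast_nonneg
  linarith

theorem differentiableAt_GammaSeq {s : ℂ} (hs : 0 < s.re) {n : ℕ} (hn : n ≠ 0) :
    DifferentiableAt ℂ (fun z => GammaSeq z n) s := by
  unfold GammaSeq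
  have h1 : DifferentiableAt ℂ (fun z : ℂ => (n : ℂ) ^ z) s :=
    differentiableAt_id.const_cpow (Or.inl (by exact_mod_cast hn))
  have h2 : DifferentiableAt ℂ (fun z : ℂ => ∏ j ∈ Finset.range (n + 1), (z + (j : ℂ))) s := by
    fun_prop
  exact (h1.mul_const _).div h2
    (Finset.prod_ne_zero_iff.2 fun j _ => add_natCast_ne_zero_of_re_pos hs j)

theorem tendsto_iteratedDeriv_GammaSeq {s : ℂ} (hs : 0 < s.re) (k : ℕ) :
    Tendsto (fun n => iteratedDeriv k (fun z => GammaSeq z n) s) atTop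
      (𝓝 (iteratedDeriv k Gamma s)) := by
  have hR : 0 < s.re / 2 := half_pos hs
  have hre {z : ℂ} (hz : z ∈ closedBall s (s.re / 2)) : 0 < z.re := by
    have h1 := (abs_re_le_norm (z - s)).trans (mem_closedBall_iff_norm.1 hz)
    rw [sub_re] at h1
    linarith [(abs_le.1 h1).1]
  have hcont : ContinuousOn (fun z : ℂ => Real.Gamma z.re) (sphere s (s.re / 2)) := by
    intro z hz
    have hz' := hre (sphere_subset_closedBall hz)
    have h1 : ContinuousAt Real.Gamma z.re :=
      (Real.differentiableAt_Gamma fun m h => by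
        have : (0 : ℝ) ≤ m := m.cast_nonneg
        linarith).continuousAt
    exact (ContinuousAt.comp (f := re) h1 continuous_re.continuousAt).continuousWithinAt
  obtain ⟨C, hC⟩ := (isCompact_sphere s (s.re / 2)).exists_bound_of_continuousOn hcont
  refine tendsto_iteratedDeriv_of_bounded (C := C) hR ?_ ?_ ?_
    (fun z _ => GammaSeq_tendsto_Gamma z) k
  · filter_upwards [eventually_ne_atTop 0] with n hn z hz
    exact (differentiableAt_GammaSeq (hre hz) hn).differentiableWithinAt
  · intro z hz
    refine (differentiableAt_Gamma z fun m h => ?_).differentiableWithinAt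
    have h1 := hre hz
    rw [h] at h1
    simp at h1
    have : (0 : ℝ) ≤ m := m.cast_nonneg
    linarith
  · filter_upwards [eventually_ne_atTop 0] with n hn z hz
    exact (norm_GammaSeq_le (hre (sphere_subset_closedBall hz)) hn).trans
      ((le_abs_self _).trans (hC z hz))

/-- The identity `(f' / f)' f² = f'' f - f'²`. -/
theorem deriv_logDeriv_mul_sq {f : ℂ → ℂ} {z : ℂ} (hf : AnalyticAt ℂ f z) (h0 : f z ≠ 0) :
    deriv (logDeriv f) z * f z ^ 2 = iteratedDeriv 2 f z * f z - deriv f z ^ 2 := by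
  have h1 : logDeriv f = fun w => deriv f w / f w := rfl
  rw [h1, deriv_fun_div hf.deriv.differentiableAt hf.differentiableAt h0, iteratedDeriv_succ,
    iteratedDeriv_one]
  field_simp

theorem logDeriv_GammaSeq {s : ℂ} (hs : 0 < s.re) {n : ℕ} (hn : n ≠ 0) :
    logDeriv (fun z => GammaSeq z n) s =
      Complex.log n - ∑ j ∈ Finset.range (n + 1), (s + j)⁻¹ := by
  have hn' : (n : ℂ) ≠ 0 := by exact_mod_cast hn
  have hd1 : HasDerivAt (fun z : ℂ => (n : ℂ) ^ z) ((n : ℂ) ^ s * Complex.log n) s := by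
    simpa using (hasDerivAt_id s).const_cpow (c := (n : ℂ)) (Or.inl hn')
  have hp : (n : ℂ) ^ s ≠ 0 := by simp [cpow_eq_zero_iff, hn']
  have hfac : (n.factorial : ℂ) ≠ 0 := by exact_mod_cast n.factorial_ne_zero
  have hj (j : ℕ) := add_natCast_ne_zero_of_re_pos hs j
  unfold GammaSeq
  rw [logDeriv_div (f := fun z : ℂ => (n : ℂ) ^ z * n.factorial) s
    (mul_ne_zero hp hfac) (Finset.prod_ne_zero_iff.2 fun j _ => hj j)
    (hd1.differentiableAt.mul_const _) (by fun_prop), logDeriv_mul_const _ _ hfac,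
    logDeriv_apply, hd1.deriv, mul_div_cancel_left₀ _ hp,
    logDeriv_prod (fun j _ => hj j) (fun j _ => by fun_prop)]
  congr 1
  refine Finset.sum_congr rfl fun j _ => ?_
  simp [logDeriv_apply]

theorem deriv_logDeriv_GammaSeq {s : ℂ} (hs : 0 < s.re) {n : ℕ} (hn : n ≠ 0) :
    deriv (logDeriv fun z => GammaSeq z n) s =
      ∑ j ∈ Finset.range (n + 1), 1 / ((j : ℂ) + s) ^ 2 := by
  have hev : (logDeriv fun z => GammaSeq z n) =ᶠ[𝓝 s]
      fun z => Complex.log n - ∑ j ∈ Finset.range (n + 1), (z + j)⁻¹ := by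
    filter_upwards [(isOpen_lt continuous_const continuous_re).mem_nhds hs] with z hz
    exact logDeriv_GammaSeq hz hn
  have hd (j : ℕ) : HasDerivAt (fun z : ℂ => (z + j)⁻¹) (-1 / (s + j) ^ 2) s := by
    exact ((hasDerivAt_id s).add_const (j : ℂ)).fun_inv (add_natCast_ne_zero_of_re_pos hs j)
  have hsum := (HasDerivAt.fun_sum (u := Finset.range (n + 1)) fun j _ => hd j).const_sub
    (Complex.log n)
  rw [hev.deriv_eq, hsum.deriv, ← Finset.sum_neg_distrib]
  refine Finset.sum_congr rfl fun j _ => ?_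
  rw [add_comm s, neg_div, neg_neg]

/-- On the right half plane the equation is the limit of `f'' f - f'² = (f' / f)' f²` for Euler's
approximations `f` of `Γ`, for which `(f' / f)'` is a partial sum of the series of `H₁`. -/
theorem Gamma_diffEq_of_re_pos {s : ℂ} (hs : 0 < s.re) :
    iteratedDeriv 2 Gamma s * Gamma s - deriv Gamma s ^ 2 - hOne s * Gamma s ^ 2 = 0 := by
  have h0 := GammaSeq_tendsto_Gamma s
  have h1 := tendsto_iteratedDeriv_GammaSeq hs 1
  have h2 := tendsto_iteratedDeriv_GammaSeq hs 2
  simp only [iteratedDeriv_one] at h1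
  have hH : Tendsto (fun n : ℕ => ∑ j ∈ Finset.range (n + 1), 1 / ((j : ℂ) + s) ^ 2) atTop
      (𝓝 (hOne s)) :=
    (summable_one_div_add_sq s).hasSum.tendsto_sum_nat.comp (tendsto_add_atTop_nat 1)
  refine tendsto_nhds_unique (((h2.mul h0).sub (h1.pow 2)).sub (hH.mul (h0.pow 2))) ?_
  refine tendsto_const_nhds.congr' ?_
  filter_upwards [eventually_ne_atTop 0] with n hn
  have hopen : IsOpen {z : ℂ | 0 < z.re} := isOpen_lt continuous_const continuous_re
  have han : AnalyticAt ℂ (fun z => GammaSeq z n) s :=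
    DifferentiableOn.analyticAt (s := {z : ℂ | 0 < z.re})
      (fun w hw => (differentiableAt_GammaSeq hw hn).differentiableWithinAt) (hopen.mem_nhds hs)
  have hne : GammaSeq s n ≠ 0 := by
    have hn' : (n : ℂ) ≠ 0 := by exact_mod_cast hn
    refine div_ne_zero (mul_ne_zero ?_ ?_)
      (Finset.prod_ne_zero_iff.2 fun j _ => add_natCast_ne_zero_of_re_pos hs j)
    · simp [cpow_eq_zero_iff, hn']
    · exact_mod_cast n.factorial_ne_zero
  rw [← deriv_logDeriv_mul_sq han hne, deriv_logDeriv_GammaSeq hs hn, sub_self]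

/-- In Mathlib `Γ` takes the junk value `0` at its poles and nowhere else, so this set is the domain
`ℂ \ {0, -1, -2, …}`. -/
theorem isOpen_setOf_Gamma_ne_zero : IsOpen {z : ℂ | Gamma z ≠ 0} := by
  have h : {z : ℂ | Gamma z ≠ 0} = (fun z => (Gamma z)⁻¹) ⁻¹' {0}ᶜ := by
    ext z
    simp
  rw [h]
  exact isOpen_compl_singleton.preimage differentiable_one_div_Gamma.continuous

theorem analyticOnNhd_Gamma : AnalyticOnNhd ℂ Gamma {z | Gamma z ≠ 0} := by
  refine DifferentiableOn.analyticOnNhd (fun z hz => ?_) isOpen_setOf_Gamma_ne_zero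
  exact (differentiableAt_Gamma z fun m h =>
    hz ((Gamma_eq_zero_iff z).2 ⟨m, h⟩)).differentiableWithinAt

theorem isPreconnected_setOf_Gamma_ne_zero : IsPreconnected {z : ℂ | Gamma z ≠ 0} := by
  have h : {z : ℂ | Gamma z ≠ 0} = (Set.range fun m : ℕ => -(m : ℂ))ᶜ := by
    ext z
    simp [Gamma_eq_zero_iff, eq_comm]
  rw [h]
  exact ((Set.countable_range _).isPathConnected_compl_of_one_lt_rank
    (by rw [rank_real_complex]; exact Cardinal.one_lt_two)).isConnected.isPreconnected

/-- The identity theorem extends the equation from the right half plane. -/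
theorem Gamma_diffEq {z : ℂ} (hz : ∀ m : ℕ, z ≠ -(m : ℂ)) :
    iteratedDeriv 2 Gamma z * Gamma z - deriv Gamma z ^ 2 - hOne z * Gamma z ^ 2 = 0 := by
  have hH : AnalyticOnNhd ℂ hOne {z | Gamma z ≠ 0} := fun w hw =>
    analyticAt_hOne fun m h => hw ((Gamma_eq_zero_iff w).2 ⟨m, h⟩)
  have hG := analyticOnNhd_Gamma
  have hG2 : AnalyticOnNhd ℂ (iteratedDeriv 2 Gamma) {z | Gamma z ≠ 0} := fun w hw => by
    have h := (hG w hw).deriv.deriv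
    rwa [← iteratedDeriv_one (f := Gamma), ← iteratedDeriv_succ] at h
  have han : AnalyticOnNhd ℂ (fun w => iteratedDeriv 2 Gamma w * Gamma w - deriv Gamma w ^ 2
      - hOne w * Gamma w ^ 2) {z | Gamma z ≠ 0} :=
    ((hG2.mul hG).sub (hG.deriv.pow 2)).sub (hH.mul (hG.pow 2))
  refine han.eqOn_zero_of_preconnected_of_eventuallyEq_zero isPreconnected_setOf_Gamma_ne_zero
    (z₀ := 1) (by simp [Gamma_one]) ?_ (Gamma_ne_zero hz)
  filter_upwards [(isOpen_lt continuous_const continuous_re).mem_nhds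
    (show (0 : ℝ) < (1 : ℂ).re by simp)] with w hw
  exact Gamma_diffEq_of_re_pos hw

theorem exists_isLogBranchAt {f : ℂ → ℂ} {z : ℂ} (hf : AnalyticAt ℂ f z) (h0 : f z ≠ 0) :
    ∃ g, IsLogBranchAt g f z := by
  -- Dividing by `f z` keeps the argument of the principal logarithm near `1`.
  refine ⟨fun w => Complex.log (f w / f z) + Complex.log (f z), ?_, ?_⟩
  · refine ((hf.div analyticAt_const h0).clog ?_).add analyticAt_const
    simp [h0]
  · filter_upwards [hf.continuousAt.eventually_ne h0] with w hw
    rw [Complex.exp_add, exp_log (div_ne_zero hw h0), exp_log h0, div_mul_cancel₀ _ h0]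

theorem IsLogBranchAt.iteratedDeriv_two_mul_sq {g f : ℂ → ℂ} {z : ℂ} (hg : IsLogBranchAt g f z) :
    iteratedDeriv 2 g z * f z ^ 2 = iteratedDeriv 2 f z * f z - deriv f z ^ 2 := by
  obtain ⟨han, hev⟩ := hg
  have hf : AnalyticAt ℂ f z := han.cexp.congr hev
  have h0 : f z ≠ 0 := by
    rw [← hev.self_of_nhds]
    exact exp_ne_zero _
  have hlog : logDeriv f =ᶠ[𝓝 z] deriv g := by
    filter_upwards [hev.eventually_nhds, han.eventually_analyticAt] with w hw hgw
    have hw' : (fun u => exp (g u)) =ᶠ[𝓝 w] f := hw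
    rw [logDeriv_apply, ← hw'.deriv_eq, ← hw'.self_of_nhds,
      hgw.differentiableAt.hasDerivAt.cexp.deriv, mul_div_cancel_left₀ _ (exp_ne_zero _)]
  rw [← deriv_logDeriv_mul_sq hf h0, hlog.deriv_eq, iteratedDeriv_succ, iteratedDeriv_one]

end Gamma

theorem mainTheorem6 :
    (∀ z : ℂ, (∀ m : ℕ, z ≠ -(m : ℂ)) →
      HasSum (fun n : ℕ => 1 / ((n : ℂ) + z) ^ 2) (hOne z) ∧
      ((∃ g : ℂ → ℂ, IsLogBranchAt g Complex.Gamma z) ∧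
        ∀ g : ℂ → ℂ, IsLogBranchAt g Complex.Gamma z → iteratedDeriv 2 g z = hOne z) ∧
      iteratedDeriv 2 Complex.Gamma z * Complex.Gamma z - deriv Complex.Gamma z ^ 2
        - hOne z * Complex.Gamma z ^ 2 = 0) ∧
    IsDifferentiallyTranscendental hOne := by
  refine ⟨fun z hz => ?_, isDifferentiallyTranscendental_hOne⟩
  have h0 : Complex.Gamma z ≠ 0 := Complex.Gamma_ne_zero hz
  refine ⟨(summable_one_div_add_sq z).hasSum,
    ⟨exists_isLogBranchAt (analyticOnNhd_Gamma z h0) h0, fun g hg => ?_⟩, Gamma_diffEq hz⟩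
  refine mul_right_cancel₀ (pow_ne_zero 2 h0) ?_
  rw [hg.iteratedDeriv_two_mul_sq, ← sub_eq_zero]
  exact Gamma_diffEq hz
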